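/- A class $\mathcal K$ of Hausdorff topological spaces is called \emph{almost Polish} if it is closed under finite products and under passage to closed subspaces, and satisfies: (1) every member of $\mathcal K$ is Lindelöf (every open cover has a countable subcover); (2) no nonempty member of $\mathcal K$ is meager in itself (i.e. a countable union of nowhere dense subsets of itself); (3) for every $X\in\mathcal K$, every $\mathcal K$-analytic set $A\subseteq X$ is almost open, i.e. there is an open set $U\subseteq X$ such that the symmetric difference $(A\setminus U)\cup(U\setminus A)$ is meager in $X$. Here a subset $A$ of a space $X\in\mathcal K$ is called \emph{$\mathcal K$-analytic} if $A=\psi(Z)$ for some $Z\in\mathcal K$ and some continuous map $\psi:Z\to X$. A topological group $G\in\mathcal K$ is called \emph{rigid within $\mathcal K$} if for every topological group $K\in\mathcal K$, every surjective (not necessarily continuous) group homomorphism $\phi:K\to G$ whose kernel is a $\mathcal K$-analytic subset of $K$ is continuous and open. \textbf{Corollary.} Let $G$ be a compact (finite-dimensional, real, smooth) Lie group whose Lie algebra is semisimple. Then $G$ is rigid within every almost Polish class $\mathcal K$ that contains $G$. -/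

import Mathlib

open scoped Manifold ContDiff

universe u

/-- A class of topological spaces. -/
abbrev SpaceClass : Type (u + 1) := ∀ (X : Type u) [TopologicalSpace X], Prop

/-- A subset of a topological space is *almost open* if it differs from some open set by a
meager set. -/
def IsAlmostOpen {X : Type u} [TopologicalSpace X] (A : Set X) : Prop :=
  ∃ U : Set X, IsOpen U ∧ IsMeagre (symmDiff A U)

namespace SpaceClass

/-- A subset `A` of a space `X` is *`𝓚`-analytic* if it is the image of a member of `𝓚` under
a continuous map. (This is used for members `X` of `𝓚`.) -/
def IsAnalytic (𝓚 : SpaceClass.{u}) {X : Type u} [TopologicalSpace X] (A : Set X) : Prop :=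
  ∃ (Z : Type u) (_ : TopologicalSpace Z) (ψ : Z → X), 𝓚 Z ∧ Continuous ψ ∧ Set.range ψ = A

/-- *Almost Polish* classes of Hausdorff spaces. Since such a class is closed under the passage to
closed subspaces, it may contain the empty space, which is trivially meager in itself;
so `not_meagre` is a condition on the nonempty members. -/
structure IsAlmostPolish (𝓚 : SpaceClass.{u}) : Prop where
  t2Space : ∀ (X : Type u) [TopologicalSpace X], 𝓚 X → T2Space X
  of_isClosed : ∀ (X : Type u) [TopologicalSpace X] (A : Set X), 𝓚 X → IsClosed A → 𝓚 A
  prod : ∀ (X Y : Type u) [TopologicalSpace X] [TopologicalSpace Y], 𝓚 X → 𝓚 Y → 𝓚 (X × Y)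
  lindelof : ∀ (X : Type u) [TopologicalSpace X], 𝓚 X → LindelofSpace X
  not_meagre : ∀ (X : Type u) [TopologicalSpace X] [Nonempty X], 𝓚 X →
    ¬ IsMeagre (Set.univ : Set X)
  isAlmostOpen : ∀ (X : Type u) [TopologicalSpace X] (A : Set X), 𝓚 X → 𝓚.IsAnalytic A →
    IsAlmostOpen A

/-- A topological group `G` in `𝓚` is *rigid within `𝓚`* if every abstract surjective
homomorphism onto `G` from a topological group in `𝓚`, with `𝓚`-analytic kernel, is continuous
and open. -/
def IsRigid (𝓚 : SpaceClass.{u}) (G : Type u) [TopologicalSpace G] [Group G] : Prop :=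
  𝓚 G ∧ ∀ (K : Type u) [TopologicalSpace K] [Group K] [IsTopologicalGroup K], 𝓚 K →
    ∀ φ : K →* G, Function.Surjective φ → 𝓚.IsAnalytic (φ.ker : Set K) →
      Continuous φ ∧ IsOpenMap φ

end SpaceClass

/-- A smooth Lie group is smooth enough for Mathlib's bracket on its Lie algebra. -/
instance lieGroupMinSmoothnessThree {n : ℕ} {G : Type u} [TopologicalSpace G]
    [ChartedSpace (EuclideanSpace ℝ (Fin n)) G] [Group G] [LieGroup (𝓡 n) ∞ G] :
    LieGroup (𝓡 n) (minSmoothness ℝ 3) G :=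
  LieGroup.of_le (n := ∞) (by
    rw [minSmoothness_of_isRCLikeNormedField]
    exact WithTop.coe_le_coe.2 (le_top : (3 : ℕ∞) ≤ ⊤))

/-! For fixed `a` in a group `H`, put C(a) = {a g a⁻¹ g⁻¹ : g ∈ H}. Such sets are visible both to
abstract homomorphisms and to the topology. If φ : K → G is a surjection, the preimage of C(φ
k₁)⋯C(φ kₘ) is C(k₁)⋯C(kₘ)·ker φ, a product of continuous images of members of the class, hence
analytic and almost open. If the product in G is an identity neighborhood, countably many translates
of the preimage cover K, so the preimage is not meager, and Pettis' lemma makes its difference set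
an identity neighborhood. Continuity therefore follows once these products form arbitrarily small
identity neighborhoods (`isRigid_of_commutatorProdSet`); openness follows from Pettis' lemma in G.

Smallness comes from compactness: C(a) shrinks to 1 as a → 1, so a product with a fixed number of
factors stays in any prescribed neighborhood. That it is a neighborhood comes from semisimplicity: g
↦ a g a⁻¹ g⁻¹ has derivative Ad a − 1 at 1. A functional killing the ranges of Ad a − 1 for all a
near 1 kills all brackets, by differentiation in a, and so vanishes because a semisimple Lie algebra
is perfect. Hence these ranges contain a basis, and n = dim G commutator factors give a map to which
the inverse function theorem applies. -/

open Set Filter Topology Pointwise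

/-! ### Category in Lindelöf groups -/

section Pettis

variable {H : Type*} [TopologicalSpace H] [Group H] [IsTopologicalGroup H]

theorem exists_countable_iUnion_smul_eq_univ [LindelofSpace H] {U : Set H} (hU : U ∈ 𝓝 (1 : H)) :
    ∃ s : Set H, s.Countable ∧ ⋃ g ∈ s, g • U = univ := by
  obtain ⟨s, hs, h⟩ := LindelofSpace.elim_nhds_subcover (fun g : H => g • U)
    (fun g => by simpa using smul_mem_nhds_smul g hU)
  exact ⟨s, hs, h⟩

theorem IsMeagre.smul {A : Set H} (hA : IsMeagre A) (g : H) : IsMeagre (g • A) := by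
  rw [← preimage_smul_inv]
  exact hA.preimage_of_isOpenMap (continuous_const_smul _) (isOpenMap_smul _)

theorem not_isMeagre_of_iUnion_smul_eq_univ (hH : ¬ IsMeagre (univ : Set H)) {A s : Set H}
    (hs : s.Countable) (h : ⋃ g ∈ s, g • A = univ) : ¬ IsMeagre A := fun hA =>
  hH (h ▸ isMeagre_biUnion hs fun g _ => hA.smul g)

/-- **Pettis' lemma** in a Lindelöf group that is not meagre in itself. -/
theorem IsAlmostOpen.div_mem_nhds_one {H : Type u} [TopologicalSpace H] [Group H]
    [IsTopologicalGroup H] [LindelofSpace H]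
    (hH : ¬ IsMeagre (univ : Set H)) {A : Set H} (hA : IsAlmostOpen A) (hA' : ¬ IsMeagre A) :
    A / A ∈ 𝓝 (1 : H) := by
  obtain ⟨U, hU, hm⟩ := hA
  have hne : U.Nonempty := by
    by_contra h
    rw [not_nonempty_iff_eq_empty] at h
    subst h
    exact hA' (hm.mono (by simp [symmDiff_def]))
  obtain ⟨u, hu⟩ := hne
  have key : ∀ᶠ x in 𝓝 (1 : H), x⁻¹ * u ∈ U := by
    have : Tendsto (fun x : H => x⁻¹ * u) (𝓝 1) (𝓝 (1⁻¹ * u)) :=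
      (continuous_inv.mul continuous_const).tendsto 1
    exact this.eventually (hU.mem_nhds (by simpa using hu))
  filter_upwards [key] with x hx
  have hO : IsOpen (U ∩ x • U) := hU.inter (hU.smul x)
  have huO : u ∈ U ∩ x • U := ⟨hu, by rwa [mem_smul_set_iff_inv_smul_mem]⟩
  -- A nonempty open set is not meager, since countably many of its translates cover the group.
  have hnm : ¬ IsMeagre (U ∩ x • U) := by
    have h1 : u⁻¹ • (U ∩ x • U) ∈ 𝓝 (1 : H) := by
      simpa using smul_mem_nhds_smul u⁻¹ (hO.mem_nhds huO)
    obtain ⟨s, hs, h⟩ := exists_countable_iUnion_smul_eq_univ h1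
    exact fun h' => not_isMeagre_of_iUnion_smul_eq_univ hH hs h (h'.smul _)
  -- Off both meager sets, A agrees with U and xA with xU, so a remaining point y lies in A ∩ xA,
  -- and x = y (x⁻¹y)⁻¹.
  have : ((U ∩ x • U) \ (symmDiff A U ∪ x • symmDiff A U)).Nonempty := by
    rw [sdiff_nonempty]
    exact fun h => hnm ((hm.union (hm.smul x)).mono h)
  obtain ⟨y, ⟨hyU, hyU'⟩, hy⟩ := this
  simp only [mem_union, not_or, mem_symmDiff, mem_smul_set_iff_inv_smul_mem] at hy hyU'
  have hyA : y ∈ A := by tauto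
  have hyA' : x⁻¹ • y ∈ A := by tauto
  exact ⟨y, hyA, x⁻¹ • y, hyA', by simp⟩

end Pettis

/-! ### Products of commutators and automatic continuity -/

/-- The image of a group under `g ↦ a * g * a⁻¹ * g⁻¹`. -/
def commutatorImage {H : Type*} [Group H] (a : H) : Set H := range fun g => a * g * a⁻¹ * g⁻¹

/-- The products `⁅a₁, g₁⁆ * ⋯ * ⁅aₘ, gₘ⁆` for fixed `aᵢ`. -/
def commutatorProdSet {H : Type*} [Group H] (l : List H) : Set H := (l.map commutatorImage).prod

/-- Lifting `g` through φ changes a product only by a kernel element, and φ⁻¹(S) absorbs the kernel.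
-/
theorem preimage_commutatorImage_mul {H K : Type*} [Group H] [Group K] {φ : K →* H}
    (hφ : Function.Surjective φ) (a : K) (S : Set H) :
    φ ⁻¹' (commutatorImage (φ a) * S) = commutatorImage a * φ ⁻¹' S := by
  ext x
  simp only [mem_preimage, Set.mem_mul, commutatorImage, mem_range, exists_exists_eq_and]
  constructor
  · rintro ⟨g, s, hs, h⟩
    obtain ⟨k, rfl⟩ := hφ g
    refine ⟨k, (a * k * a⁻¹ * k⁻¹)⁻¹ * x, ?_, by group⟩
    have : φ ((a * k * a⁻¹ * k⁻¹)⁻¹ * x) = s := by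
      rw [map_mul, ← h]; simp only [map_mul, map_inv]; group
    rwa [this]
  · rintro ⟨k, y, hy, rfl⟩
    exact ⟨φ k, φ y, hy, by simp⟩

namespace SpaceClass

variable {𝓚 : SpaceClass.{u}} {K : Type u} [TopologicalSpace K] [Group K] [IsTopologicalGroup K]

theorem IsAlmostPolish.isAnalytic_mul (h𝓚 : 𝓚.IsAlmostPolish) {A B : Set K}
    (hA : 𝓚.IsAnalytic A) (hB : 𝓚.IsAnalytic B) : 𝓚.IsAnalytic (A * B) := by
  obtain ⟨Z, _, ψ, hZ, hψ, rfl⟩ := hA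
  obtain ⟨Z', _, ψ', hZ', hψ', rfl⟩ := hB
  refine ⟨Z × Z', inferInstance, fun p => ψ p.1 * ψ' p.2, h𝓚.prod _ _ hZ hZ',
    (hψ.comp continuous_fst).mul (hψ'.comp continuous_snd), ?_⟩
  ext x
  simp [Set.mem_mul]

theorem isAnalytic_commutatorImage (hK : 𝓚 K) (a : K) : 𝓚.IsAnalytic (commutatorImage a) :=
  ⟨K, inferInstance, fun g => a * g * a⁻¹ * g⁻¹, hK, by fun_prop, rfl⟩

theorem IsAlmostPolish.isAnalytic_preimage_commutatorProdSet (h𝓚 : 𝓚.IsAlmostPolish) (hK : 𝓚 K)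
    {G : Type u} [Group G] {φ : K →* G} (hφ : Function.Surjective φ)
    (hker : 𝓚.IsAnalytic (φ.ker : Set K)) (l : List G) :
    𝓚.IsAnalytic (φ ⁻¹' commutatorProdSet l) := by
  induction l with
  | nil =>
    have : φ ⁻¹' commutatorProdSet ([] : List G) = φ.ker := by
      ext x
      simp [commutatorProdSet, MonoidHom.mem_ker]
    rwa [this]
  | cons g l ih =>
    obtain ⟨a, rfl⟩ := hφ g
    have := preimage_commutatorImage_mul hφ a (commutatorProdSet l)
    simp only [commutatorProdSet, List.map_cons, List.prod_cons] at this ih ⊢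
    rw [this]
    exact h𝓚.isAnalytic_mul (isAnalytic_commutatorImage hK a) ih

/-- A group in an almost Polish class is rigid if it has arbitrarily small identity
neighborhoods that consist of all products of commutators with given first entries. -/
theorem IsAlmostPolish.isRigid_of_commutatorProdSet (h𝓚 : 𝓚.IsAlmostPolish)
    {G : Type u} [TopologicalSpace G] [Group G] [IsTopologicalGroup G] (hG : 𝓚 G)
    (hsmall : ∀ V ∈ 𝓝 (1 : G), ∃ l : List G,
      commutatorProdSet l ∈ 𝓝 (1 : G) ∧ commutatorProdSet l ⊆ V) :
    𝓚.IsRigid G := by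
  refine ⟨hG, fun K _ _ _ hK φ hφ hker => ?_⟩
  have := h𝓚.lindelof G hG
  have := h𝓚.lindelof K hK
  have hGm := h𝓚.not_meagre G hG
  have hKm := h𝓚.not_meagre K hK
  have hcont : Continuous φ := by
    refine continuous_of_continuousAt_one φ ?_
    rw [ContinuousAt, map_one]
    intro W hW
    have hW' : (fun p : G × G => p.1 / p.2) ⁻¹' W ∈ 𝓝 (1 : G) ×ˢ 𝓝 (1 : G) := by
      rw [← nhds_prod_eq]
      exact continuous_div'.continuousAt.preimage_mem_nhds (by simpa using hW)
    obtain ⟨V, hV, hVW⟩ := mem_prod_same_iff.1 hW'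
    obtain ⟨l, hl, hlV⟩ := hsmall V hV
    set A := commutatorProdSet l
    obtain ⟨s, hs, hsA⟩ := exists_countable_iUnion_smul_eq_univ hl
    choose f hf using hφ
    have hcov : ⋃ k ∈ f '' s, k • (φ ⁻¹' A) = univ := by
      refine eq_univ_of_forall fun x => ?_
      have hx : φ x ∈ ⋃ g ∈ s, g • A := hsA ▸ mem_univ _
      simp only [mem_iUnion, mem_smul_set_iff_inv_smul_mem, exists_prop] at hx
      obtain ⟨g, hg, hgx⟩ := hx
      simp only [mem_iUnion, mem_smul_set_iff_inv_smul_mem, exists_prop]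
      exact ⟨f g, mem_image_of_mem _ hg, by simpa [hf] using hgx⟩
    have hA := h𝓚.isAlmostOpen K _ hK
      (h𝓚.isAnalytic_preimage_commutatorProdSet hK (fun y => ⟨f y, hf y⟩) hker l)
    refine mem_map.2 <| mem_of_superset (hA.div_mem_nhds_one hKm
      (not_isMeagre_of_iUnion_smul_eq_univ hKm (hs.image f) hcov)) ?_
    rintro _ ⟨x, hx, y, hy, rfl⟩
    have := hVW (mk_mem_prod (hlV hx) (hlV hy))
    simpa using this
  refine ⟨hcont, ?_⟩
  rw [IsTopologicalGroup.isOpenMap_iff_nhds_one]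
  intro W hW
  rw [mem_map] at hW
  have hW' : (fun p : K × K => p.1 / p.2) ⁻¹' (φ ⁻¹' W) ∈ 𝓝 (1 : K) ×ˢ 𝓝 (1 : K) := by
    rw [← nhds_prod_eq]
    exact continuous_div'.continuousAt.preimage_mem_nhds (by simpa using hW)
  obtain ⟨V, hV, hVW⟩ := mem_prod_same_iff.1 hW'
  -- C must be closed, so that it belongs to the class and its image under the now continuous φ is
  -- analytic.
  obtain ⟨C, hC, hCc, hCV⟩ := exists_mem_nhds_isClosed_subset hV
  obtain ⟨s, hs, hsC⟩ := exists_countable_iUnion_smul_eq_univ hC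
  have hcov : ⋃ g ∈ φ '' s, g • (φ '' C) = univ := by
    refine eq_univ_of_forall fun x => ?_
    obtain ⟨k, rfl⟩ := hφ x
    have hx : k ∈ ⋃ g ∈ s, g • C := hsC ▸ mem_univ _
    simp only [mem_iUnion, mem_smul_set_iff_inv_smul_mem, exists_prop] at hx
    obtain ⟨g, hg, hgx⟩ := hx
    simp only [mem_iUnion, mem_smul_set_iff_inv_smul_mem, exists_prop]
    exact ⟨φ g, mem_image_of_mem _ hg, _, hgx, by simp⟩
  have hA : IsAlmostOpen (φ '' C) := h𝓚.isAlmostOpen G _ hG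
    ⟨C, inferInstance, fun c => φ c, h𝓚.of_isClosed K C hK hCc,
      hcont.comp continuous_subtype_val, by rw [image_eq_range]⟩
  refine mem_of_superset (hA.div_mem_nhds_one hGm
    (not_isMeagre_of_iUnion_smul_eq_univ hGm (hs.image φ) hcov)) ?_
  rintro _ ⟨_, ⟨x, hx, rfl⟩, _, ⟨y, hy, rfl⟩, rfl⟩
  have := hVW (mk_mem_prod (hCV hx) (hCV hy))
  simpa using this

end SpaceClass

/-! ### Calculus in a local group -/

section LocalGroup

variable {E : Type*} [NormedAddCommGroup E] [NormedSpace ℝ E] {m : E × E → E} {e : E}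

theorem fderiv_apply_inl_of_right_id {a : E} (hm : DifferentiableAt ℝ m (a, e))
    (h : ∀ᶠ x in 𝓝 a, m (x, e) = x) (X : E) : fderiv ℝ m (a, e) (X, 0) = X := by
  have h1 : HasFDerivAt (fun x : E => (x, e)) (ContinuousLinearMap.inl ℝ E E) a :=
    hasFDerivAt_prodMk_left a e
  have h2 := (hm.hasFDerivAt.comp a h1).unique ((hasFDerivAt_id a).congr_of_eventuallyEq h)
  simpa using congr($h2 X)

theorem fderiv_apply_inr_of_left_id {a : E} (hm : DifferentiableAt ℝ m (e, a))
    (h : ∀ᶠ y in 𝓝 a, m (e, y) = y) (X : E) : fderiv ℝ m (e, a) (0, X) = X := by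
  have h1 : HasFDerivAt (fun x : E => (e, x)) (ContinuousLinearMap.inr ℝ E E) a :=
    hasFDerivAt_prodMk_right e a
  have h2 := (hm.hasFDerivAt.comp a h1).unique ((hasFDerivAt_id a).congr_of_eventuallyEq h)
  simpa using congr($h2 X)

/-- In a local group, if `κ x = a * x * a⁻¹ * x⁻¹`, then the derivative of left translation minus
that of right translation by `a` factors through the derivative of `κ`. -/
theorem fderiv_mul_left_sub_fderiv_mul_right {a : E} {κ : E → E} (hκ : DifferentiableAt ℝ κ e)
    (hκe : κ e = e) (hae : DifferentiableAt ℝ m (a, e)) (hea : DifferentiableAt ℝ m (e, a))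
    (hid : ∀ᶠ y in 𝓝 a, m (e, y) = y)
    (h : ∀ᶠ x in 𝓝 e, m (κ x, m (x, a)) = m (a, x)) (X : E) :
    fderiv ℝ m (a, e) (0, X) - fderiv ℝ m (e, a) (X, 0) =
      fderiv ℝ m (e, a) (fderiv ℝ κ e X, 0) := by
  have h1 : HasFDerivAt (fun x : E => m (a, x)) _ e :=
    hae.hasFDerivAt.comp e (hasFDerivAt_prodMk_right a e)
  have h2 : HasFDerivAt (fun x : E => m (x, a)) _ e :=
    hea.hasFDerivAt.comp e (hasFDerivAt_prodMk_left e a)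
  have h3 : HasFDerivAt (fun x : E => (κ x, m (x, a))) _ e := hκ.hasFDerivAt.prodMk h2
  have ha : m (e, a) = a := hid.self_of_nhds
  have h4 : HasFDerivAt m (fderiv ℝ m (e, a)) (κ e, m (e, a)) := by
    rw [hκe, ha]; exact hea.hasFDerivAt
  have h5 : HasFDerivAt (fun x : E => m (κ x, m (x, a))) _ e := h4.comp e h3
  have h6 := congr($((h1.congr_of_eventuallyEq h).unique h5) X)
  simp only [ContinuousLinearMap.comp_apply, ContinuousLinearMap.prod_apply,
    ContinuousLinearMap.inl_apply, ContinuousLinearMap.inr_apply] at h6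
  have h7 : ∀ Y Z : E, fderiv ℝ m (e, a) (Y, Z) = fderiv ℝ m (e, a) (Y, 0) + Z := fun Y Z => by
    conv_rhs => rw [← fderiv_apply_inr_of_left_id hea hid Z]
    rw [← map_add]; simp
  rw [h6, h7 _ (fderiv ℝ m (e, a) (X, 0))]
  abel

/-- A linear functional that vanishes on the ranges of `Ad a - 1` for all `a` near the identity
vanishes on brackets. -/
theorem apply_lieBracket_eq_zero_of_eventually [CompleteSpace E] (hm : ContDiffAt ℝ 2 m (e, e))
    (h1 : ∀ᶠ x in 𝓝 e, m (x, e) = x) (h2 : ∀ᶠ y in 𝓝 e, m (e, y) = y)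
    {T : E → E →L[ℝ] E} {l : E →L[ℝ] ℝ}
    (hT : ∀ᶠ a in 𝓝 e, ∀ X,
      fderiv ℝ m (a, e) (0, X) - fderiv ℝ m (e, a) (X, 0) = fderiv ℝ m (e, a) (T a X, 0))
    (hl : ∀ᶠ a in 𝓝 e, ∀ X, l (T a X) = 0) (X Y : E) :
    l (VectorField.lieBracket ℝ (fun a => fderiv ℝ m (a, e) (0, X))
      (fun a => fderiv ℝ m (a, e) (0, Y)) e) = 0 := by
  have hd : DifferentiableAt ℝ m (e, e) := hm.differentiableAt (by norm_num)
  have hd' : HasFDerivAt (fderiv ℝ m) (fderiv ℝ (fderiv ℝ m) (e, e)) (e, e) :=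
    ((hm.fderiv_right (m := 1) (by norm_num)).differentiableAt (by norm_num)).hasFDerivAt
  set D := fderiv ℝ (fderiv ℝ m) (e, e)
  have hsymm : ∀ v w, D v w = D w v := hm.isSymmSndFDerivAt (by simp)
  have hL : HasFDerivAt (fun a => fderiv ℝ m (a, e)) (D ∘L .inl ℝ E E) e :=
    HasFDerivAt.comp (f := fun a => (a, e)) e hd' (hasFDerivAt_prodMk_left e e)
  have hR : HasFDerivAt (fun a => fderiv ℝ m (e, a)) (D ∘L .inr ℝ E E) e :=
    HasFDerivAt.comp (f := fun a => (e, a)) e hd' (hasFDerivAt_prodMk_right e e)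
  have hLv : ∀ v : E × E, HasFDerivAt (fun a => fderiv ℝ m (a, e) v)
      ((D ∘L .inl ℝ E E).flip v) e := fun v => by
    simpa using hL.clm_apply (hasFDerivAt_const v e)
  have hRv : ∀ v : E × E, HasFDerivAt (fun a => fderiv ℝ m (e, a) v)
      ((D ∘L .inr ℝ E E).flip v) e := fun v => by
    simpa using hR.clm_apply (hasFDerivAt_const v e)
  -- `B a` is the derivative at e of right translation by a. It is invertible near e, so `T a` can
  -- be recovered from the difference of the translation derivatives.
  set B : E → E →L[ℝ] E := fun a => fderiv ℝ m (e, a) ∘L .inl ℝ E E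
  have hB : DifferentiableAt ℝ B e :=
    (hR.clm_comp (hasFDerivAt_const (ContinuousLinearMap.inl ℝ E E) e)).differentiableAt
  have hBe : B e = 1 := by
    ext v
    simpa [B] using fderiv_apply_inl_of_right_id hd h1 v
  have hinv : DifferentiableAt ℝ (fun a => Ring.inverse (B a)) e := by
    have : DifferentiableAt ℝ (Ring.inverse : (E →L[ℝ] E) → _) (B e) :=
      differentiableAt_inverse (hBe ▸ isUnit_one)
    exact this.comp e hB
  have hunit : ∀ᶠ a in 𝓝 e, IsUnit (B a) :=
    hB.continuousAt.eventually (Units.isOpen.mem_nhds (hBe ▸ isUnit_one : IsUnit (B e)))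
  have hN := (hLv (0, Y)).sub (hRv (Y, 0))
  have hzero : (fun a => l (Ring.inverse (B a)
      (fderiv ℝ m (a, e) (0, Y) - fderiv ℝ m (e, a) (Y, 0)))) =ᶠ[𝓝 e] fun _ => 0 := by
    filter_upwards [hunit, hT, hl] with a ha hTa hla
    rw [hTa Y]
    have h3 : fderiv ℝ m (e, a) (T a Y, 0) = B a (T a Y) := by simp [B]
    rw [h3, ← mul_apply_eq_comp, Ring.inverse_mul_cancel _ ha]
    exact hla Y
  have hq := l.hasFDerivAt.comp e (hinv.hasFDerivAt.clm_apply hN)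
  have hz := congr($(hq.unique ((hasFDerivAt_const (0 : ℝ) e).congr_of_eventuallyEq hzero)) X)
  have hr := fderiv_apply_inl_of_right_id hd h1
  have hl' := fderiv_apply_inr_of_left_id hd h2
  -- The derivative of B⁻¹ contributes nothing, because it is applied to the difference of
  -- translations at e, which is Y − Y = 0. By symmetry of D, what remains is the bracket.
  have hz' : l (D (X, 0) (0, Y) - D (0, X) (Y, 0)) = 0 := by
    simpa [hBe, hr, hl'] using hz
  rw [VectorField.lieBracket, (hLv (0, X)).fderiv, (hLv (0, Y)).fderiv, hl', hl']
  simpa [hsymm (0, X) (Y, 0)] using hz'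

end LocalGroup

/-! ### The Lie group in its chart at the identity -/

section LieGroupChart

variable {n : ℕ} {G : Type*} [TopologicalSpace G] [ChartedSpace (EuclideanSpace ℝ (Fin n)) G]

theorem ContMDiffAt.contDiffAt_extChartAt [IsManifold (𝓡 n) ∞ G] {F : Type*}
    [NormedAddCommGroup F] [NormedSpace ℝ F] {f : F → G} {x : F} {g : G}
    (hf : ContMDiffAt 𝓘(ℝ, F) (𝓡 n) ∞ f x) (hx : f x ∈ (extChartAt (𝓡 n) g).source) :
    ContDiffAt ℝ ∞ (fun y => extChartAt (𝓡 n) g (f y)) x := by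
  rw [← contMDiffAt_iff_contDiffAt]
  exact ContMDiffAt.comp x (contMDiffAt_extChartAt' (by simpa using hx)) hf

theorem contMDiffAt_extChartAt_symm_of_mem [IsManifold (𝓡 n) ∞ G] {g : G}
    {x : EuclideanSpace ℝ (Fin n)}
    (hx : x ∈ (extChartAt (𝓡 n) g).target) :
    ContMDiffAt 𝓘(ℝ, EuclideanSpace ℝ (Fin n)) (𝓡 n) ∞ (extChartAt (𝓡 n) g).symm x :=
  (contMDiffOn_extChartAt_symm g).contMDiffAt
    ((isOpen_extChartAt_target g).mem_nhds hx)

variable [Group G]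

variable (n G) in
/-- The multiplication of a Lie group, read in the chart at the identity. -/
noncomputable def chartMul
    (p : EuclideanSpace ℝ (Fin n) × EuclideanSpace ℝ (Fin n)) : EuclideanSpace ℝ (Fin n) :=
  extChartAt (𝓡 n) (1 : G) ((extChartAt (𝓡 n) (1 : G)).symm p.1 *
    (extChartAt (𝓡 n) (1 : G)).symm p.2)

variable (n G) in
/-- The identity of a Lie group, read in the chart at the identity. -/
noncomputable def chartOne : EuclideanSpace ℝ (Fin n) := extChartAt (𝓡 n) (1 : G) 1

/-- The map `g ↦ a * g * a⁻¹ * g⁻¹` of a Lie group, read in the chart at the identity. -/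
noncomputable def chartCommutator (a : G) (x : EuclideanSpace ℝ (Fin n)) :
    EuclideanSpace ℝ (Fin n) :=
  extChartAt (𝓡 n) (1 : G) (a * (extChartAt (𝓡 n) (1 : G)).symm x * a⁻¹ *
    ((extChartAt (𝓡 n) (1 : G)).symm x)⁻¹)

theorem extChartAt_symm_chartOne : (extChartAt (𝓡 n) (1 : G)).symm (chartOne n G) = 1 :=
  extChartAt_to_inv 1

theorem chartOne_mem_target : chartOne n G ∈ (extChartAt (𝓡 n) (1 : G)).target :=
  mem_extChartAt_target 1

theorem eventually_mem_target_chartOne :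
    ∀ᶠ x in 𝓝 (chartOne n G), x ∈ (extChartAt (𝓡 n) (1 : G)).target :=
  (isOpen_extChartAt_target 1).mem_nhds chartOne_mem_target

theorem chartMul_chartOne_right {x : EuclideanSpace ℝ (Fin n)}
    (hx : x ∈ (extChartAt (𝓡 n) (1 : G)).target) :
    chartMul n G (x, chartOne n G) = x := by
  rw [chartMul, extChartAt_symm_chartOne, mul_one, PartialEquiv.right_inv _ hx]

theorem chartMul_chartOne_left {x : EuclideanSpace ℝ (Fin n)}
    (hx : x ∈ (extChartAt (𝓡 n) (1 : G)).target) :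
    chartMul n G (chartOne n G, x) = x := by
  rw [chartMul, extChartAt_symm_chartOne, one_mul, PartialEquiv.right_inv _ hx]

theorem chartCommutator_chartOne (a : G) : chartCommutator a (chartOne n G) = chartOne n G := by
  rw [chartCommutator, extChartAt_symm_chartOne, mul_one, mul_inv_cancel, inv_one, mul_one,
    chartOne]

variable [LieGroup (𝓡 n) ∞ G]

theorem contDiffAt_chartMul {p : EuclideanSpace ℝ (Fin n) × EuclideanSpace ℝ (Fin n)}
    (h1 : p.1 ∈ (extChartAt (𝓡 n) (1 : G)).target)
    (h2 : p.2 ∈ (extChartAt (𝓡 n) (1 : G)).target)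
    (h : (extChartAt (𝓡 n) (1 : G)).symm p.1 * (extChartAt (𝓡 n) (1 : G)).symm p.2 ∈
      (extChartAt (𝓡 n) (1 : G)).source) : ContDiffAt ℝ ∞ (chartMul n G) p := by
  refine ContMDiffAt.contDiffAt_extChartAt (G := G) (f := fun p :
      EuclideanSpace ℝ (Fin n) × EuclideanSpace ℝ (Fin n) =>
    (extChartAt (𝓡 n) (1 : G)).symm p.1 * (extChartAt (𝓡 n) (1 : G)).symm p.2) ?_ h
  exact ((contMDiffAt_extChartAt_symm_of_mem h1).comp p contDiff_fst.contMDiff.contMDiffAt).mul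
    ((contMDiffAt_extChartAt_symm_of_mem h2).comp p contDiff_snd.contMDiff.contMDiffAt)

theorem contDiffAt_chartMul_left {x : EuclideanSpace ℝ (Fin n)}
    (hx : x ∈ (extChartAt (𝓡 n) (1 : G)).target) :
    ContDiffAt ℝ ∞ (chartMul n G) (x, chartOne n G) :=
  contDiffAt_chartMul hx chartOne_mem_target (by
    simpa only [extChartAt_symm_chartOne, mul_one, one_mul] using
      (extChartAt (𝓡 n) (1 : G)).map_target hx)

theorem contDiffAt_chartMul_right {x : EuclideanSpace ℝ (Fin n)}
    (hx : x ∈ (extChartAt (𝓡 n) (1 : G)).target) :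
    ContDiffAt ℝ ∞ (chartMul n G) (chartOne n G, x) :=
  contDiffAt_chartMul chartOne_mem_target hx (by
    simpa only [extChartAt_symm_chartOne, mul_one, one_mul] using
      (extChartAt (𝓡 n) (1 : G)).map_target hx)

theorem contDiffAt_chartCommutator (a : G) :
    ContDiffAt ℝ ∞ (chartCommutator a) (chartOne n G) := by
  refine ContMDiffAt.contDiffAt_extChartAt (G := G) (f := fun x : EuclideanSpace ℝ (Fin n) =>
    a * (extChartAt (𝓡 n) (1 : G)).symm x * a⁻¹ *
    ((extChartAt (𝓡 n) (1 : G)).symm x)⁻¹) ?_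
    (by
      rw [extChartAt_symm_chartOne, mul_one, mul_inv_cancel, inv_one, mul_one]
      exact mem_extChartAt_source (I := 𝓡 n) 1)
  have h := contMDiffAt_extChartAt_symm_of_mem (n := n) (G := G) chartOne_mem_target
  exact ((contMDiffAt_const.mul h).mul contMDiffAt_const).mul h.inv

/-- This is (a x a⁻¹ x⁻¹)(x a) = a x, valid for x so close to 1 that the commutator and x a lie in
the chart domain. -/
theorem chartMul_chartCommutator {a : EuclideanSpace ℝ (Fin n)}
    (ha : a ∈ (extChartAt (𝓡 n) (1 : G)).target) :
    ∀ᶠ x in 𝓝 (chartOne n G),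
      chartMul n G (chartCommutator ((extChartAt (𝓡 n) (1 : G)).symm a) x,
        chartMul n G (x, a)) = chartMul n G (a, x) := by
  have := topologicalGroup_of_lieGroup (𝓡 n) (G := G) ∞
  set φ := extChartAt (𝓡 n) (1 : G)
  have hc : ContinuousAt φ.symm (chartOne n G) := continuousAt_extChartAt_symm 1
  have hs : φ.source ∈ 𝓝 (1 : G) := extChartAt_source_mem_nhds 1
  have h1 : ∀ᶠ x in 𝓝 (chartOne n G), φ.symm a * φ.symm x * (φ.symm a)⁻¹ * (φ.symm x)⁻¹ ∈
      φ.source := by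
    refine ((((continuousAt_const.mul hc).mul continuousAt_const).mul hc.inv).eventually ?_)
    have : φ.symm (chartOne n G) = 1 := extChartAt_symm_chartOne
    simpa [this] using hs
  have h2 : ∀ᶠ x in 𝓝 (chartOne n G), φ.symm x * φ.symm a ∈ φ.source := by
    refine (hc.mul continuousAt_const).eventually ?_
    have : φ.symm (chartOne n G) = 1 := extChartAt_symm_chartOne
    rw [Pi.mul_apply, this, one_mul]
    exact (isOpen_extChartAt_source (1 : G)).mem_nhds (φ.map_target ha)
  filter_upwards [h1, h2] with x hx1 hx2
  change φ (φ.symm (φ _) * φ.symm (φ _)) = φ (φ.symm a * φ.symm x)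
  rw [φ.left_inv hx1, φ.left_inv hx2]
  exact congrArg φ (by group)

/-- Near 1, left translation followed by the chart is the chart followed by `chartMul` with fixed
first argument, and the derivative of the chart at its own base point is the identity. -/
theorem mpullbackWithin_mulInvariantVectorField_eq_fderiv_chartMul
    (X : GroupLieAlgebra (𝓡 n) G) {x : EuclideanSpace ℝ (Fin n)}
    (hx : x ∈ (extChartAt (𝓡 n) (1 : G)).target) :
    VectorField.mpullbackWithin 𝓘(ℝ, EuclideanSpace ℝ (Fin n)) (𝓡 n) (extChartAt (𝓡 n) (1 : G)).symm
      (mulInvariantVectorField X) (range (𝓡 n)) x =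
      fderiv ℝ (chartMul n G) (x, chartOne n G) (0, (X : EuclideanSpace ℝ (Fin n))) := by
  have : IsManifold (𝓡 n) 1 G := .of_le (n := ∞) (by simp)
  have := topologicalGroup_of_lieGroup (𝓡 n) (G := G) ∞
  set φ := extChartAt (𝓡 n) (1 : G) with hφ
  set g := φ.symm x
  have hg : g ∈ φ.source := φ.map_target hx
  have hinv : (mfderivWithin 𝓘(ℝ, EuclideanSpace ℝ (Fin n)) (𝓡 n) φ.symm (range (𝓡 n)) x).inverse =
      mfderiv (𝓡 n) 𝓘(ℝ, EuclideanSpace ℝ (Fin n)) φ g :=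
    ContinuousLinearMap.inverse_eq
      (mfderivWithin_extChartAt_symm_comp_mfderiv_extChartAt hx)
      (mfderiv_extChartAt_comp_mfderivWithin_extChartAt_symm hx)
  rw [VectorField.mpullbackWithin_apply, hinv, mulInvariantVectorField]
  have hmul : HasMFDerivAt (𝓡 n) (𝓡 n) (g * ·) (1 : G) (mfderiv (𝓡 n) (𝓡 n) (g * ·) (1 : G)) :=
    ((contMDiff_mul_left (I := 𝓡 n) (n := ∞) (a := g)).mdifferentiable (by simp) 1).hasMFDerivAt
  have hφg : HasMFDerivAt (𝓡 n) 𝓘(ℝ, EuclideanSpace ℝ (Fin n)) φ (g * 1)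
      (mfderiv (𝓡 n) 𝓘(ℝ, EuclideanSpace ℝ (Fin n)) φ (g * 1)) :=
    (mdifferentiableAt_extChartAt (by simpa [hφ] using hg)).hasMFDerivAt
  have hcomp := hφg.comp (1 : G) hmul
  have hφ1 : HasMFDerivAt (𝓡 n) 𝓘(ℝ, EuclideanSpace ℝ (Fin n)) φ (1 : G)
      (ContinuousLinearMap.id ℝ (EuclideanSpace ℝ (Fin n))) := by
    have := (mdifferentiableAt_extChartAt (I := 𝓡 n) (mem_chart_source _ (1 : G))).hasMFDerivAt
    rwa [mfderiv_extChartAt_self] at this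
  have hm : HasFDerivAt (fun y => chartMul n G (x, y))
      (fderiv ℝ (chartMul n G) (x, chartOne n G) ∘L .inr ℝ _ _) (φ 1) :=
    ((contDiffAt_chartMul_left hx).differentiableAt (by simp)).hasFDerivAt.comp (chartOne n G)
      (hasFDerivAt_prodMk_right x (chartOne n G))
  have hcomp' := hm.hasMFDerivAt.comp (1 : G) hφ1
  have heq : (φ ∘ (g * ·)) =ᶠ[𝓝 (1 : G)] (fun y => chartMul n G (x, y)) ∘ φ := by
    filter_upwards [extChartAt_source_mem_nhds (I := 𝓡 n) (1 : G)] with h hh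
    change φ _ = φ (φ.symm x * φ.symm (φ h))
    rw [φ.left_inv hh]
  have hu := hasMFDerivAt_unique hcomp (hcomp'.congr_of_eventuallyEq heq)
  have := congr($hu X)
  rw [mul_one] at this
  refine this.trans ?_
  change fderiv ℝ (chartMul n G) (x, chartOne n G) (ContinuousLinearMap.inr ℝ _ _ X) = _
  rfl

/-- This carries the manifold bracket over to the coordinate computation of
`apply_lieBracket_eq_zero_of_eventually`. -/
theorem groupLieAlgebra_bracket_eq_lieBracket (X Y : GroupLieAlgebra (𝓡 n) G) :
    ⁅X, Y⁆ = VectorField.lieBracket ℝ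
      (fun a => fderiv ℝ (chartMul n G) (a, chartOne n G) (0, (X : EuclideanSpace ℝ (Fin n))))
      (fun a => fderiv ℝ (chartMul n G) (a, chartOne n G) (0, (Y : EuclideanSpace ℝ (Fin n))))
      (chartOne n G) := by
  have : IsManifold (𝓡 n) 1 G := .of_le (n := ∞) (by simp)
  rw [GroupLieAlgebra.bracket_def, ← VectorField.mlieBracketWithin_univ,
    VectorField.mlieBracketWithin_apply, mfderiv_extChartAt_self]
  refine (congr($(ContinuousLinearMap.inverse_id (R := ℝ)
      (M := EuclideanSpace ℝ (Fin n))) _)).trans ?_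
  rw [ContinuousLinearMap.id_apply]
  have h : ∀ Z : GroupLieAlgebra
      (𝓡 n) G, VectorField.mpullbackWithin 𝓘(ℝ, EuclideanSpace ℝ (Fin n)) (𝓡 n)
      (extChartAt (𝓡 n) (1 : G)).symm (mulInvariantVectorField Z) (range (𝓡 n)) =ᶠ[𝓝 (chartOne n G)]
      (fun a => fderiv ℝ (chartMul n G) (a, chartOne n G) (0, (Z : EuclideanSpace ℝ (Fin n)))) :=
      fun Z => by
    filter_upwards [eventually_mem_target_chartOne] with x hx
    exact mpullbackWithin_mulInvariantVectorField_eq_fderiv_chartMul Z hx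
  have hu : (extChartAt (𝓡 n) (1 : G)).symm ⁻¹' univ ∩ range (𝓡 n) = univ := by simp
  rw [hu]
  refine (congrFun VectorField.lieBracketWithin_univ _).trans ?_
  exact (h X).lieBracket_vectorField_eq (h Y)

end LieGroupChart

/-- Semisimple algebras are perfect: a minimal ideal I is not abelian, so [I, I] = I, and the
minimal ideals span. -/
theorem LieAlgebra.IsSemisimple.eq_zero_of_forall_lie {R L M : Type*} [CommRing R] [LieRing L]
    [LieAlgebra R L] [LieAlgebra.IsSemisimple R L] [AddCommGroup M] [Module R M] {l : L →ₗ[R] M}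
    (h : ∀ x y : L, l ⁅x, y⁆ = 0) : l = 0 := by
  rw [← LinearMap.ker_eq_top, eq_top_iff, ← LieSubmodule.top_toSubmodule (R := R) (L := L) (M := L),
    ← LieAlgebra.IsSemisimple.sSup_atoms_eq_top (R := R) (L := L),
    LieSubmodule.sSup_toSubmodule_eq_iSup, iSup₂_le_iff]
  intro I hI
  have hne : ⁅I, I⁆ ≠ ⊥ := fun hbot =>
    LieAlgebra.IsSemisimple.non_abelian_of_isAtom I hI
      ((LieSubmodule.lie_abelian_iff_lie_self_eq_bot I).2 hbot)
  have heq : ⁅I, I⁆ = I := (hI.le_iff.1 (LieSubmodule.lie_le_right I I)).resolve_left hne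
  rw [← heq, LieSubmodule.lieIdeal_oper_eq_linear_span', Submodule.span_le]
  rintro _ ⟨x, -, y, -, rfl⟩
  exact h x y

/-- The commutator map sends {1} × H to 1, so by compactness of H all of C(a) is small once a is
near 1. The number k of factors is fixed before W is chosen. -/
theorem exists_nhds_one_commutatorProdSet_subset {H : Type*} [TopologicalSpace H] [Group H]
    [IsTopologicalGroup H] [CompactSpace H] (k : ℕ) {V : Set H} (hV : V ∈ 𝓝 (1 : H)) :
    ∃ W ∈ 𝓝 (1 : H), ∀ l : List H, l.length = k → (∀ a ∈ l, a ∈ W) →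
      commutatorProdSet l ⊆ V := by
  induction k generalizing V with
  | zero =>
    refine ⟨univ, univ_mem, fun l hl _ => ?_⟩
    obtain rfl := List.length_eq_zero_iff.1 hl
    simpa [commutatorProdSet] using mem_of_mem_nhds hV
  | succ k ih =>
    obtain ⟨V', hV', hVV⟩ := exists_nhds_one_split hV
    obtain ⟨W, hW, hWV⟩ := ih hV'
    have hc : ∀ᶠ a in 𝓝 (1 : H), ∀ g ∈ (univ : Set H), a * g * a⁻¹ * g⁻¹ ∈ V' := by
      refine isCompact_univ.eventually_forall_of_forall_eventually fun g _ => ?_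
      have : ContinuousAt (fun p : H × H => p.1 * p.2 * p.1⁻¹ * p.2⁻¹) (1, g) := by fun_prop
      exact this.eventually (by simpa using hV')
    refine ⟨_, inter_mem hW hc, fun l hl hlW => ?_⟩
    obtain ⟨a, l, rfl⟩ := List.exists_cons_of_length_eq_add_one hl
    simp only [commutatorProdSet, List.map_cons, List.prod_cons]
    rintro _ ⟨x, ⟨g, rfl⟩, y, hy, rfl⟩
    exact hVV _ ((hlW a (by simp)).2 g (mem_univ g)) _
      (hWV l (by simpa using hl) (fun b hb => (hlW b (by simp [hb])).1) hy)

/-! ### Commutator products as identity neighborhoods -/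

section LieGroupCommutators

variable {n : ℕ} {G : Type*} [TopologicalSpace G] [ChartedSpace (EuclideanSpace ℝ (Fin n)) G]
  [Group G] [LieGroup (𝓡 n) ∞ G]

theorem span_fderiv_chartCommutator_eq_top
    (hG : ∀ l : (EuclideanSpace ℝ (Fin n)) →ₗ[ℝ] ℝ, (∀ X Y : GroupLieAlgebra
        (𝓡 n) G, l (⁅X, Y⁆ : _) = 0) → l = 0)
    {W : Set G} (hW : W ∈ 𝓝 (1 : G)) :
    Submodule.span ℝ {v : EuclideanSpace ℝ (Fin n) | ∃ a ∈ W, ∃ X : EuclideanSpace ℝ (Fin n),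
      fderiv ℝ (chartCommutator a) (chartOne n G) X = v} = ⊤ := by
  by_contra hne
  obtain ⟨l, hl0, hl⟩ := Submodule.exists_le_ker_of_lt_top _ (lt_top_iff_ne_top.2 hne)
  refine hl0 (hG l fun X Y => ?_)
  rw [groupLieAlgebra_bracket_eq_lieBracket]
  have hc : ContinuousAt (extChartAt (𝓡 n) (1 : G)).symm (chartOne n G) :=
    continuousAt_extChartAt_symm 1
  have hW' : ∀ᶠ a in 𝓝 (chartOne n G), (extChartAt (𝓡 n) (1 : G)).symm a ∈ W :=
    hc.eventually (by rwa [extChartAt_symm_chartOne])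
  have htar := eventually_mem_target_chartOne (n := n) (G := G)
  refine apply_lieBracket_eq_zero_of_eventually (m := chartMul n G) (e := chartOne n G)
    (T := fun a => fderiv ℝ (chartCommutator ((extChartAt (𝓡 n) (1 : G)).symm a)) (chartOne n G))
    (l := LinearMap.toContinuousLinearMap l)
    ((contDiffAt_chartMul_left chartOne_mem_target).of_le
      (WithTop.coe_le_coe.2 (le_top : (2 : ℕ∞) ≤ ⊤)))
    (htar.mono fun x hx => chartMul_chartOne_right hx)
    (htar.mono fun x hx => chartMul_chartOne_left hx) ?_ ?_ X Y
  · filter_upwards [htar] with a ha Z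
    exact fderiv_mul_left_sub_fderiv_mul_right
      ((contDiffAt_chartCommutator _).differentiableAt (by simp)) (chartCommutator_chartOne _)
      ((contDiffAt_chartMul_left ha).differentiableAt (by simp))
      ((contDiffAt_chartMul_right ha).differentiableAt (by simp))
      (((isOpen_extChartAt_target 1).eventually_mem ha).mono
        fun y hy => chartMul_chartOne_left hy)
      (chartMul_chartCommutator ha) Z
  · filter_upwards [hW'] with a ha Z
    exact hl (Submodule.subset_span ⟨_, ha, Z, rfl⟩)

/-- Moving the i-th commutator variable along `X i` with speed the i-th coordinate gives a product
map with derivative ∑ bᵢ* ⊗ bᵢ = id at 0, so it maps neighborhoods of 0 onto neighborhoods of 1. -/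
theorem commutatorProdSet_mem_nhds_one {ι : Type*} [Fintype ι]
    (b : Module.Basis ι ℝ (EuclideanSpace ℝ (Fin n)))
    (a : ι → G) (X : ι → EuclideanSpace ℝ (Fin n))
    (hb : ∀ i, fderiv ℝ (chartCommutator (a i)) (chartOne n G) (X i) = b i) :
    commutatorProdSet ((Finset.univ : Finset ι).toList.map a) ∈ 𝓝 (1 : G) := by
  have := topologicalGroup_of_lieGroup (𝓡 n) (G := G) ∞
  set φ := extChartAt (𝓡 n) (1 : G) with hφ
  set e := chartOne n G
  have hφe : φ.symm e = 1 := extChartAt_symm_chartOne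
  have hφ1 : φ 1 = e := rfl
  let c : ι → (EuclideanSpace ℝ (Fin n)) → EuclideanSpace ℝ (Fin n) :=
      fun i x => e + b.coord i x • X i
  let γ : ι → (EuclideanSpace ℝ (Fin n)) → G := fun i x =>
    a i * φ.symm (c i x) * (a i)⁻¹ * (φ.symm (c i x))⁻¹
  let F : List ι → (EuclideanSpace ℝ (Fin n)) → G := fun L x => (L.map fun i => γ i x).prod
  let D : ι → (EuclideanSpace ℝ (Fin n)) →L[ℝ] EuclideanSpace ℝ (Fin n) := fun i =>
    (LinearMap.toContinuousLinearMap (b.coord i)).smulRight (b i)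
  have hc0 : ∀ i, c i 0 = e := fun i => by simp [c]
  have hc : ∀ i, HasStrictFDerivAt (c i)
      ((LinearMap.toContinuousLinearMap (b.coord i)).smulRight (X i)) 0 := fun i =>
    ((LinearMap.toContinuousLinearMap (b.coord i)).smulRight (X i)).hasStrictFDerivAt.const_add e
  have hγ0 : ∀ i, γ i 0 = 1 := fun i => by simp [γ, hc0, hφe]
  have hγc : ∀ i, ContinuousAt (γ i) 0 := fun i => by
    have h1 : ContinuousAt φ.symm (c i 0) := by
      rw [hc0]; exact continuousAt_extChartAt_symm 1
    have h2 : ContinuousAt (fun x => φ.symm (c i x)) 0 :=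
      ContinuousAt.comp (g := φ.symm) h1 (hc i).continuousAt
    exact ((continuousAt_const.mul h2).mul continuousAt_const).mul h2.inv
  have hγd : ∀ i, HasStrictFDerivAt (fun x => φ (γ i x)) (D i) 0 := fun i => by
    have h1 : HasStrictFDerivAt (chartCommutator (a i))
        (fderiv ℝ (chartCommutator (a i)) e) (c i 0) := by
      rw [hc0]
      exact (contDiffAt_chartCommutator (a i)).hasStrictFDerivAt (by simp)
    refine (h1.comp 0 (hc i)).congr_fderiv ?_
    ext1 x
    simp [D, hb]
  have hsrc : ∀ {f : (EuclideanSpace ℝ (Fin n)) → G},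
      ContinuousAt f 0 → f 0 = 1 → ∀ᶠ x in 𝓝 0, f x ∈ φ.source :=
    fun hf h => hf.eventually (by rw [h]; exact extChartAt_source_mem_nhds 1)
  have hF : ∀ L : List ι, F L 0 = 1 ∧ ContinuousAt (F L) 0 ∧
      HasStrictFDerivAt (fun x => φ (F L x)) (L.map D).sum 0 := fun L => by
    induction L with
    | nil => exact ⟨rfl, continuousAt_const,
      (hasStrictFDerivAt_const (φ 1) (0 : EuclideanSpace ℝ (Fin n)) :
          HasStrictFDerivAt (fun _ : EuclideanSpace ℝ (Fin n) => φ 1) _ _)⟩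
    | cons i L ih =>
      obtain ⟨h0, hcont, hd⟩ := ih
      have hcons : ∀ x, F (i :: L) x = γ i x * F L x := fun x => by simp [F]
      refine ⟨by rw [hcons, h0, hγ0, one_mul], ?_, ?_⟩
      · simp only [funext hcons]
        exact (hγc i).mul hcont
      · have hm : HasStrictFDerivAt (chartMul n G) (fderiv ℝ (chartMul n G) (e, e))
            (φ (γ i 0), φ (F L 0)) := by
          rw [h0, hγ0, hφ1]
          exact (contDiffAt_chartMul_left chartOne_mem_target).hasStrictFDerivAt (by simp)
        have hmd : DifferentiableAt ℝ (chartMul n G) (e, e) :=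
          (contDiffAt_chartMul_left chartOne_mem_target).differentiableAt (by simp)
        have htar := eventually_mem_target_chartOne (n := n) (G := G)
        have hcomp := hm.comp (0 : EuclideanSpace ℝ (Fin n)) ((hγd i).prodMk hd)
        refine (hcomp.congr_fderiv ?_).congr_of_eventuallyEq ?_
        · ext1 x
          have hadd : ∀ Y Z : EuclideanSpace ℝ (Fin n),
              fderiv ℝ (chartMul n G) (e, e) (Y, Z) = Y + Z := fun Y Z => by
            have h1 := fderiv_apply_inl_of_right_id hmd
              (htar.mono fun x hx => chartMul_chartOne_right hx) Y
            have h2 := fderiv_apply_inr_of_left_id hmd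
              (htar.mono fun x hx => chartMul_chartOne_left hx) Z
            conv_rhs => rw [← h1, ← h2, ← map_add]
            simp
          simp [hadd]
        · filter_upwards [hsrc (hγc i) (hγ0 i), hsrc hcont h0] with x hx1 hx2
          change φ (φ.symm (φ _) * φ.symm (φ _)) = φ _
          rw [φ.left_inv hx1, φ.left_inv hx2, hcons]
  set L := (Finset.univ : Finset ι).toList with hL
  obtain ⟨h0, hcont, hd⟩ := hF L
  have hid : (L.map D).sum = ContinuousLinearMap.id ℝ _ := by
    rw [hL, Finset.sum_map_toList]
    ext1 x
    simp [D, b.sum_repr x]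
  have hmap : map (fun x => φ (F L x)) (𝓝 0) = 𝓝 e := by
    rw [hd.map_nhds_eq_of_surj (by rw [hid]; exact LinearMap.range_id), h0, hφ1]
  have hmap' : map (F L) (𝓝 0) = 𝓝 1 := by
    have h1 : F L =ᶠ[𝓝 0] φ.symm ∘ fun x => φ (F L x) := by
      filter_upwards [hsrc hcont h0] with x hx
      exact (φ.left_inv hx).symm
    have h2 : map φ.symm (𝓝 e) = 𝓝 1 := by
      have h3 := map_extChartAt_symm_nhdsWithin_range (I := 𝓡 n) (1 : G)
      rwa [ModelWithCorners.range_eq_univ, nhdsWithin_univ] at h3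
    rw [map_congr h1, ← map_map, hmap, h2]
  rw [← hmap', mem_map]
  refine univ_mem' fun x => ?_
  change F L x ∈ commutatorProdSet (L.map a)
  -- The membership holds for every list, so L is generalized before the induction.
  clear hd hcont h0 hid hmap hmap'
  clear_value L
  clear hL
  induction L with
  | nil => simp [F, commutatorProdSet]
  | cons i L ih =>
    simp only [F, commutatorProdSet, List.map_cons, List.prod_cons] at ih ⊢
    exact Set.mul_mem_mul ⟨_, rfl⟩ ih

/-- In a compact semisimple Lie group, the sets of products of commutators with given first entries
include arbitrarily small neighborhoods of the identity. -/
theorem exists_commutatorProdSet_mem_nhds_one [CompactSpace G]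
    (hG : LieAlgebra.IsSemisimple ℝ (GroupLieAlgebra (𝓡 n) G)) {V : Set G} (hV : V ∈ 𝓝 (1 : G)) :
    ∃ l : List G, commutatorProdSet l ∈ 𝓝 (1 : G) ∧ commutatorProdSet l ⊆ V := by
  have := topologicalGroup_of_lieGroup (𝓡 n) (G := G) ∞
  -- The number of factors will be the size of a basis, so n is known before the entries are picked
  -- from W.
  obtain ⟨W, hW, hWV⟩ := exists_nhds_one_commutatorProdSet_subset n hV
  have hspan := span_fderiv_chartCommutator_eq_top (n := n) (G := G)
    (fun l hl => LieAlgebra.IsSemisimple.eq_zero_of_forall_lie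
      (L := GroupLieAlgebra (𝓡 n) G) (l := l) hl) hW
  obtain ⟨f, hf, hfspan, hfli⟩ := Submodule.exists_fun_fin_finrank_span_eq ℝ
    {v : EuclideanSpace ℝ (Fin n) | ∃ a ∈ W, ∃ X : EuclideanSpace ℝ (Fin n),
      fderiv ℝ (chartCommutator a) (chartOne n G) X = v}
  choose a ha X hX using hf
  refine ⟨Finset.univ.toList.map a, commutatorProdSet_mem_nhds_one
    (Module.Basis.mk hfli (by rw [hfspan, hspan])) a X (by simpa using hX),
    hWV _ ?_ ?_⟩
  · rw [List.length_map, Finset.length_toList, Finset.card_univ, Fintype.card_fin, hspan,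
      finrank_top, finrank_euclideanSpace_fin]
  · simpa using ha

end LieGroupCommutators

theorem mainTheorem10 {n : ℕ} (G : Type u) [TopologicalSpace G]
    [ChartedSpace (EuclideanSpace ℝ (Fin n)) G] [Group G] [LieGroup (𝓡 n) ∞ G] [CompactSpace G]
    (hG : LieAlgebra.IsSemisimple ℝ (GroupLieAlgebra (𝓡 n) G))
    (𝓚 : SpaceClass.{u}) (h𝓚 : 𝓚.IsAlmostPolish) (hmem : 𝓚 G) :
    𝓚.IsRigid G := by
  have := topologicalGroup_of_lieGroup (𝓡 n) (G := G) ∞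
  exact h𝓚.isRigid_of_commutatorProdSet hmem fun V hV =>
    exists_commutatorProdSet_mem_nhds_one hG hV
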